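/- Theorem. The metric of a non-Kähler Vaisman manifold, compact or not, cannot be flat. Precisely, let $M$ be a smooth (finite-dimensional) manifold with an integrable almost complex structure $J$ and a Riemannian metric $g$ that is Hermitian, $g(JX,JY)=g(X,Y)$, with fundamental $2$-form $\Omega(X,Y)=g(JX,Y)$ and Levi-Civita connection $\nabla$. Suppose that $(M,J,g)$ is Vaisman, i.e. there is a closed $1$-form $\theta$ (the Lee form) such that $d\Omega=\theta\wedge\Omega$ and $\nabla\theta=0$. If $(M,J,g)$ is not Kähler, i.e. if $d\Omega$ does not vanish identically, then $g$ is not flat: the curvature tensor of $\nabla$ does not vanish identically on $M$. -/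

import Mathlib

open Bundle Manifold VectorField
open scoped ContDiff

noncomputable section

namespace VaismanFlat

section Metric

/-- A smooth Riemannian metric on the smooth manifold `M` modelled on `E`. -/
abbrev Metric (E : Type*) [NormedAddCommGroup E] [NormedSpace ℝ E]
    (M : Type*) [TopologicalSpace M] [ChartedSpace E M] [IsManifold 𝓘(ℝ, E) ∞ M] :=
  ContMDiffRiemannianMetric 𝓘(ℝ, E) ∞ E (fun x : M ↦ TangentSpace 𝓘(ℝ, E) x)

variable {E : Type*} [NormedAddCommGroup E] [NormedSpace ℝ E]
  {M : Type*} [TopologicalSpace M] [ChartedSpace E M] [IsManifold 𝓘(ℝ, E) ∞ M]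

/-- The function `g(X, Y)` of two vector fields. -/
def pairing (g : Metric E M) (X Y : Π y : M, TangentSpace 𝓘(ℝ, E) y) (y : M) : ℝ :=
  g.inner y (X y) (Y y)

theorem pairing_mdifferentiableAt (g : Metric E M) {x : M}
    {Y Z : Π y : M, TangentSpace 𝓘(ℝ, E) y} (hY : MDiffAt (T% Y) x) (hZ : MDiffAt (T% Z) x) :
    MDiffAt (pairing g Y Z) x := by
  have h : MDifferentiableAt 𝓘(ℝ, E) (𝓘(ℝ, E).prod 𝓘(ℝ))
      (fun m ↦ TotalSpace.mk' ℝ (E := Bundle.Trivial M ℝ) m (g.inner m (Y m) (Z m))) x := by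
    apply MDifferentiableAt.clm_bundle_apply₂ (F₁ := E) (F₂ := E)
    · exact g.contMDiff.mdifferentiableAt (by simp)
    · exact hY
    · exact hZ
  simp only [mdifferentiableAt_totalSpace] at h
  exact h.2

theorem pairing_comm (g : Metric E M) (Y Z : Π y : M, TangentSpace 𝓘(ℝ, E) y) :
    pairing g Y Z = pairing g Z Y :=
  funext fun y ↦ g.symm y _ _

theorem d_pairing_add (g : Metric E M) {x : M}
    {Y Y' Z : Π y : M, TangentSpace 𝓘(ℝ, E) y} (hY : MDiffAt (T% Y) x) (hY' : MDiffAt (T% Y') x)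
    (hZ : MDiffAt (T% Z) x) :
    d% (pairing g (Y + Y') Z) x = d% (pairing g Y Z) x + d% (pairing g Y' Z) x := by
  rw [← mvfderiv_add (pairing_mdifferentiableAt g hY hZ) (pairing_mdifferentiableAt g hY' hZ)]
  congr 1
  ext y
  simp [pairing]

theorem d_pairing_smul (g : Metric E M) {x : M} {f : M → ℝ}
    {Y Z : Π y : M, TangentSpace 𝓘(ℝ, E) y} (hf : MDiffAt f x) (hY : MDiffAt (T% Y) x)
    (hZ : MDiffAt (T% Z) x) :
    d% (pairing g (f • Y) Z) x = f x • d% (pairing g Y Z) x + pairing g Y Z x • d% f x := by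
  rw [← mvfderiv_mul hf (pairing_mdifferentiableAt g hY hZ)]
  congr 1
  ext y
  simp [pairing]

theorem metric_ext (g : Metric E M) (x : M) {v v' : TangentSpace 𝓘(ℝ, E) x}
    (h : ∀ w, g.inner x v w = g.inner x v' w) : v = v' := by
  by_contra hne
  have h1 := g.pos x (v - v') (sub_ne_zero.2 hne)
  have h2 : g.inner x v = g.inner x v' := ContinuousLinearMap.ext h
  rw [map_sub (g.inner x) v v', h2, sub_self] at h1
  simp at h1

/-- The Koszul expression
`X g(Y, Z) + Y g(X, Z) - Z g(X, Y) + g([X, Y], Z) - g([X, Z], Y) - g([Y, Z], X)`. -/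
def koszul (g : Metric E M) (X Y Z : Π y : M, TangentSpace 𝓘(ℝ, E) y) (x : M) : ℝ :=
  d% (pairing g Y Z) x (X x) + d% (pairing g X Z) x (Y x) - d% (pairing g X Y) x (Z x)
    + pairing g (mlieBracket 𝓘(ℝ, E) X Y) Z x - pairing g (mlieBracket 𝓘(ℝ, E) X Z) Y x
    - pairing g (mlieBracket 𝓘(ℝ, E) Y Z) X x

variable [FiniteDimensional ℝ E]

theorem koszul_tensorial_left (g : Metric E M) {x : M} {Y Z : Π y : M, TangentSpace 𝓘(ℝ, E) y}
    (hY : MDiffAt (T% Y) x) (hZ : MDiffAt (T% Z) x) :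
    TensorialAt 𝓘(ℝ, E) E (fun X : Π y : M, TangentSpace 𝓘(ℝ, E) y ↦ koszul g X Y Z x) x where
  smul {f X} hf hX := by
    simp only [koszul, d_pairing_smul g hf hX hZ, d_pairing_smul g hf hX hY]
    simp [pairing, mlieBracket_smul_left hf hX, g.symm x (X x) (Y x)]
    ring
  add {X X'} hX hX' := by
    simp only [koszul, d_pairing_add g hX hX' hZ, d_pairing_add g hX hX' hY]
    simp [pairing, mlieBracket_add_left hX hX']
    ring

theorem koszul_tensorial_right (g : Metric E M) {x : M} {X Y : Π y : M, TangentSpace 𝓘(ℝ, E) y}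
    (hX : MDiffAt (T% X) x) (hY : MDiffAt (T% Y) x) :
    TensorialAt 𝓘(ℝ, E) E (fun Z : Π y : M, TangentSpace 𝓘(ℝ, E) y ↦ koszul g X Y Z x) x where
  smul {f Z} hf hZ := by
    simp only [koszul, pairing_comm g Y (f • Z), pairing_comm g X (f • Z),
      d_pairing_smul g hf hZ hX, d_pairing_smul g hf hZ hY]
    simp [pairing, mlieBracket_smul_right hf hZ, pairing_comm g Z X, pairing_comm g Z Y,
      g.symm x (Z x)]
    ring
  add {Z Z'} hZ hZ' := by
    simp only [koszul, pairing_comm g Y (Z + Z'), pairing_comm g X (Z + Z'),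
      d_pairing_add g hZ hZ' hX, d_pairing_add g hZ hZ' hY]
    simp [pairing, mlieBracket_add_right hZ hZ', pairing_comm g Z X, pairing_comm g Z Y,
      pairing_comm g Z' X, pairing_comm g Z' Y]
    ring

theorem koszul_add_middle (g : Metric E M) {x : M} {X Y Y' Z : Π y : M, TangentSpace 𝓘(ℝ, E) y}
    (hX : MDiffAt (T% X) x) (hY : MDiffAt (T% Y) x) (hY' : MDiffAt (T% Y') x)
    (hZ : MDiffAt (T% Z) x) :
    koszul g X (Y + Y') Z x = koszul g X Y Z x + koszul g X Y' Z x := by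
  simp only [koszul, pairing_comm g X (Y + Y'), d_pairing_add g hY hY' hX,
    d_pairing_add g hY hY' hZ]
  simp [pairing, mlieBracket_add_left hY hY', mlieBracket_add_right hY hY', pairing_comm g Y X,
    pairing_comm g Y' X]
  ring

theorem koszul_smul_middle (g : Metric E M) {x : M} {f : M → ℝ}
    {X Y Z : Π y : M, TangentSpace 𝓘(ℝ, E) y} (hf : MDiffAt f x)
    (hX : MDiffAt (T% X) x) (hY : MDiffAt (T% Y) x) (hZ : MDiffAt (T% Z) x) :
    koszul g X (f • Y) Z x
      = f x * koszul g X Y Z x + 2 * (d% f x (X x) * g.inner x (Y x) (Z x)) := by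
  simp only [koszul, pairing_comm g X (f • Y), d_pairing_smul g hf hY hX,
    d_pairing_smul g hf hY hZ]
  simp [pairing, mlieBracket_smul_left hf hY, mlieBracket_smul_right hf hY, pairing_comm g Y X]
  ring

instance finiteDimensional_tangentSpace (x : M) :
    FiniteDimensional ℝ (TangentSpace 𝓘(ℝ, E) x) :=
  inferInstanceAs (FiniteDimensional ℝ E)

instance t2Space_tangentSpace (x : M) : T2Space (TangentSpace 𝓘(ℝ, E) x) :=
  inferInstanceAs (T2Space E)

/-- The metric identifies the tangent space with the cotangent space. -/
theorem bijective_inner (g : Metric E M) (x : M) :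
    Function.Bijective (g.inner x).toLinearMap := by
  have hinj : Function.Injective (g.inner x).toLinearMap := fun v v' h ↦
    metric_ext g x fun w ↦ congr($h w)
  have e : (TangentSpace 𝓘(ℝ, E) x →ₗ[ℝ] ℝ) ≃ₗ[ℝ] (TangentSpace 𝓘(ℝ, E) x →L[ℝ] ℝ) :=
    LinearMap.toContinuousLinearMap
  have : FiniteDimensional ℝ (TangentSpace 𝓘(ℝ, E) x →L[ℝ] ℝ) := e.finiteDimensional
  refine ⟨hinj, (LinearMap.injective_iff_surjective_of_finrank_eq_finrank ?_).1 hinj⟩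
  rw [← e.finrank_eq]
  exact Subspace.dual_finrank_eq.symm

/-- The musical isomorphism `T_x^*M → T_xM` of the metric. -/
def sharp (g : Metric E M) (x : M) :
    (TangentSpace 𝓘(ℝ, E) x →L[ℝ] ℝ) →ₗ[ℝ] TangentSpace 𝓘(ℝ, E) x :=
  (LinearEquiv.ofBijective _ (bijective_inner g x)).symm

theorem inner_sharp (g : Metric E M) (x : M) (φ : TangentSpace 𝓘(ℝ, E) x →L[ℝ] ℝ)
    (w : TangentSpace 𝓘(ℝ, E) x) : g.inner x (sharp g x φ) w = φ w :=
  congr($((LinearEquiv.ofBijective _ (bijective_inner g x)).apply_symm_apply φ) w)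

open Classical in
/-- The Levi-Civita derivative `v ↦ ∇_v Y` at `x`, determined by the Koszul formula
`2 g(∇_X Y, Z) = koszul g X Y Z` if `Y` is differentiable at `x`, and `0` otherwise. -/
def leviCivitaFun (g : Metric E M) (Y : Π y : M, TangentSpace 𝓘(ℝ, E) y) (x : M) :
    TangentSpace 𝓘(ℝ, E) x →L[ℝ] TangentSpace 𝓘(ℝ, E) x :=
  if hY : MDiffAt (T% Y) x then
    (sharp g x).toContinuousLinearMap ∘L ((1 / 2 : ℝ) •
      TensorialAt.mkHom₂ (fun X Z ↦ koszul g X Y Z x) x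
        (fun _ hZ ↦ koszul_tensorial_left g hY hZ) (fun _ hX ↦ koszul_tensorial_right g hX hY))
  else 0

theorem koszul_formula (g : Metric E M) {x : M} {X Y Z : Π y : M, TangentSpace 𝓘(ℝ, E) y}
    (hX : MDiffAt (T% X) x) (hY : MDiffAt (T% Y) x) (hZ : MDiffAt (T% Z) x) :
    2 * g.inner x (leviCivitaFun g Y x (X x)) (Z x) = koszul g X Y Z x := by
  have h := TensorialAt.mkHom₂_apply (Φ := fun X Z ↦ koszul g X Y Z x)
    (fun _ hZ ↦ koszul_tensorial_left g hY hZ) (fun _ hX ↦ koszul_tensorial_right g hX hY) hX hZ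
  rw [leviCivitaFun, dif_pos hY]
  simp [inner_sharp, h]

theorem leviCivitaFun_eq_of_koszul (g : Metric E M) {x : M} {Y : Π y : M, TangentSpace 𝓘(ℝ, E) y}
    (hY : MDiffAt (T% Y) x) (A : TangentSpace 𝓘(ℝ, E) x →L[ℝ] TangentSpace 𝓘(ℝ, E) x)
    (hA : ∀ X Z : Π y : M, TangentSpace 𝓘(ℝ, E) y, MDiffAt (T% X) x → MDiffAt (T% Z) x →
      koszul g X Y Z x = 2 * g.inner x (A (X x)) (Z x)) :
    leviCivitaFun g Y x = A := by
  ext v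
  refine metric_ext g x fun w ↦ ?_
  have hv := FiberBundle.mdifferentiableAt_extend 𝓘(ℝ, E) E v
  have hw := FiberBundle.mdifferentiableAt_extend 𝓘(ℝ, E) E w
  have h := (koszul_formula g hv hY hw).trans (hA _ _ hv hw)
  simp only [FiberBundle.extend_apply_self] at h
  linarith

/-- The Levi-Civita connection of `g`; `leviCivita g Y x v` is `∇_v Y` at the point `x`. -/
def leviCivita (g : Metric E M) :
    CovariantDerivative 𝓘(ℝ, E) E (fun x : M ↦ TangentSpace 𝓘(ℝ, E) x) where
  toFun := leviCivitaFun g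
  isCovariantDerivativeOnUniv :=
    { add := fun {Y Y' x} hY hY' _ ↦ by
        refine leviCivitaFun_eq_of_koszul g (mdifferentiableAt_add_section hY hY') _
          fun X Z hX hZ ↦ ?_
        rw [koszul_add_middle g hX hY hY' hZ, ← koszul_formula g hX hY hZ,
          ← koszul_formula g hX hY' hZ]
        simp
        ring
      leibniz := fun {Y f x} hY hf _ ↦ by
        refine leviCivitaFun_eq_of_koszul g (hf.smul_section hY) _ fun X Z hX hZ ↦ ?_
        rw [koszul_smul_middle g hf hX hY hZ, ← koszul_formula g hX hY hZ]
        simp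
        ring }

/-- The Levi-Civita connection is torsion-free. -/
theorem leviCivita_torsion (g : Metric E M) {x : M} {X Y : Π y : M, TangentSpace 𝓘(ℝ, E) y}
    (hX : MDiffAt (T% X) x) (hY : MDiffAt (T% Y) x) :
    leviCivita g Y x (X x) - leviCivita g X x (Y x) = mlieBracket 𝓘(ℝ, E) X Y x := by
  refine metric_ext g x fun w ↦ ?_
  have hw := FiberBundle.mdifferentiableAt_extend 𝓘(ℝ, E) E w
  have h := koszul_formula g hX hY hw
  have h' := koszul_formula g hY hX hw
  have h'' : mlieBracket 𝓘(ℝ, E) Y X x = - mlieBracket 𝓘(ℝ, E) X Y x := mlieBracket_swap_apply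
  simp only [koszul, pairing, FiberBundle.extend_apply_self, pairing_comm g Y X, h'',
    map_neg, neg_apply] at h h'
  change g.inner x (leviCivitaFun g Y x (X x) - leviCivitaFun g X x (Y x)) w = _
  simp only [map_sub, sub_apply]
  linarith

/-- The Levi-Civita connection is compatible with the metric. -/
theorem leviCivita_metric (g : Metric E M) {x : M} {X Y Z : Π y : M, TangentSpace 𝓘(ℝ, E) y}
    (hX : MDiffAt (T% X) x) (hY : MDiffAt (T% Y) x) (hZ : MDiffAt (T% Z) x) :
    d% (pairing g Y Z) x (X x)
      = g.inner x (leviCivita g Y x (X x)) (Z x) + g.inner x (Y x) (leviCivita g Z x (X x)) := by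
  have h := koszul_formula g hX hY hZ
  have h' := koszul_formula g hX hZ hY
  have h'' : mlieBracket 𝓘(ℝ, E) Z Y x = - mlieBracket 𝓘(ℝ, E) Y Z x := mlieBracket_swap_apply
  rw [g.symm x (Y x)]
  change _ = g.inner x (leviCivitaFun g Y x (X x)) (Z x)
    + g.inner x (leviCivitaFun g Z x (X x)) (Y x)
  simp only [koszul, pairing, pairing_comm g Z Y, h'', map_neg, neg_apply] at h h'
  linarith

/-- A vector field is smooth at `x`. -/
abbrev SmoothAt (X : Π y : M, TangentSpace 𝓘(ℝ, E) y) (x : M) : Prop := CMDiffAt ∞ (T% X) x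

/-- The metric is flat: the curvature `R(X, Y)Z = ∇_X ∇_Y Z - ∇_Y ∇_X Z - ∇_[X,Y] Z` of its
Levi-Civita connection vanishes identically. -/
def IsFlat (g : Metric E M) : Prop :=
  ∀ (x : M) (X Y Z : Π y : M, TangentSpace 𝓘(ℝ, E) y), SmoothAt X x → SmoothAt Y x → SmoothAt Z x →
    leviCivita g (fun y ↦ leviCivita g Z y (Y y)) x (X x)
      - leviCivita g (fun y ↦ leviCivita g Z y (X y)) x (Y x)
      - leviCivita g Z x (mlieBracket 𝓘(ℝ, E) X Y x) = 0

end Metric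

section Forms

variable {E : Type*} [NormedAddCommGroup E] [NormedSpace ℝ E]
  {M : Type*} [TopologicalSpace M] [ChartedSpace E M] [IsManifold 𝓘(ℝ, E) ∞ M]

/-- The exterior derivative `dθ(X, Y) = X θ(Y) - Y θ(X) - θ([X, Y])` of a 1-form. -/
def dOneForm (θ : Π y : M, TangentSpace 𝓘(ℝ, E) y →L[ℝ] ℝ)
    (X Y : Π y : M, TangentSpace 𝓘(ℝ, E) y) (x : M) : ℝ :=
  d% (fun y ↦ θ y (Y y)) x (X x) - d% (fun y ↦ θ y (X y)) x (Y x)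
    - θ x (mlieBracket 𝓘(ℝ, E) X Y x)

/-- The exterior derivative of a 2-form `Ω`: the cyclic sum of `X Ω(Y, Z) - Ω([X, Y], Z)`. -/
def dTwoForm (Ω : Π y : M, TangentSpace 𝓘(ℝ, E) y →L[ℝ] TangentSpace 𝓘(ℝ, E) y →L[ℝ] ℝ)
    (X Y Z : Π y : M, TangentSpace 𝓘(ℝ, E) y) (x : M) : ℝ :=
  d% (fun y ↦ Ω y (Y y) (Z y)) x (X x) + d% (fun y ↦ Ω y (Z y) (X y)) x (Y x)
    + d% (fun y ↦ Ω y (X y) (Y y)) x (Z x)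
    - Ω x (mlieBracket 𝓘(ℝ, E) X Y x) (Z x) - Ω x (mlieBracket 𝓘(ℝ, E) Y Z x) (X x)
    - Ω x (mlieBracket 𝓘(ℝ, E) Z X x) (Y x)

/-- The wedge product `θ ∧ Ω` of a 1-form and a 2-form. -/
def wedgeOneTwo (θ : Π y : M, TangentSpace 𝓘(ℝ, E) y →L[ℝ] ℝ)
    (Ω : Π y : M, TangentSpace 𝓘(ℝ, E) y →L[ℝ] TangentSpace 𝓘(ℝ, E) y →L[ℝ] ℝ)
    (X Y Z : Π y : M, TangentSpace 𝓘(ℝ, E) y) (x : M) : ℝ :=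
  θ x (X x) * Ω x (Y x) (Z x) + θ x (Y x) * Ω x (Z x) (X x) + θ x (Z x) * Ω x (X x) (Y x)

/-- The Nijenhuis bracket `[JX, JY] - J[JX, Y] - J[X, JY] + J²[X, Y]`. -/
def nijenhuis (J : Π y : M, TangentSpace 𝓘(ℝ, E) y →L[ℝ] TangentSpace 𝓘(ℝ, E) y)
    (X Y : Π y : M, TangentSpace 𝓘(ℝ, E) y) (x : M) : TangentSpace 𝓘(ℝ, E) x :=
  mlieBracket 𝓘(ℝ, E) (fun y ↦ J y (X y)) (fun y ↦ J y (Y y)) x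
    - J x (mlieBracket 𝓘(ℝ, E) (fun y ↦ J y (X y)) Y x)
    - J x (mlieBracket 𝓘(ℝ, E) X (fun y ↦ J y (Y y)) x)
    + J x (J x (mlieBracket 𝓘(ℝ, E) X Y x))

/-- `(M, J)` is a complex manifold: `J` is a smooth almost complex structure which is integrable,
that is, whose Nijenhuis tensor vanishes. -/
structure IsComplexStructure
    (J : Π y : M, TangentSpace 𝓘(ℝ, E) y →L[ℝ] TangentSpace 𝓘(ℝ, E) y) : Prop where
  smooth : ContMDiff 𝓘(ℝ, E) (𝓘(ℝ, E).prod 𝓘(ℝ, E →L[ℝ] E)) ∞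
    (fun y ↦ TotalSpace.mk' (E →L[ℝ] E)
      (E := fun y : M ↦ TangentSpace 𝓘(ℝ, E) y →L[ℝ] TangentSpace 𝓘(ℝ, E) y) y (J y))
  sq : ∀ (x : M) (v : TangentSpace 𝓘(ℝ, E) x), J x (J x v) = -v
  integrable : ∀ (x : M) (X Y : Π y : M, TangentSpace 𝓘(ℝ, E) y), SmoothAt X x → SmoothAt Y x →
    nijenhuis J X Y x = 0

/-- `(M, J, g)` is a Hermitian manifold. -/
structure IsHermitian (g : Metric E M)
    (J : Π y : M, TangentSpace 𝓘(ℝ, E) y →L[ℝ] TangentSpace 𝓘(ℝ, E) y) : Prop where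
  complex : IsComplexStructure J
  compatible : ∀ (x : M) (v w : TangentSpace 𝓘(ℝ, E) x),
    g.inner x (J x v) (J x w) = g.inner x v w

/-- The fundamental form `Ω(X, Y) = g(JX, Y)` of a Hermitian manifold. -/
def fundamentalForm (g : Metric E M)
    (J : Π y : M, TangentSpace 𝓘(ℝ, E) y →L[ℝ] TangentSpace 𝓘(ℝ, E) y) (y : M) :
    TangentSpace 𝓘(ℝ, E) y →L[ℝ] TangentSpace 𝓘(ℝ, E) y →L[ℝ] ℝ :=
  g.inner y ∘L J y

/-- `(M, J, g)` is a Kähler manifold: it is Hermitian with closed fundamental form. -/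
structure IsKahler (g : Metric E M)
    (J : Π y : M, TangentSpace 𝓘(ℝ, E) y →L[ℝ] TangentSpace 𝓘(ℝ, E) y) : Prop where
  hermitian : IsHermitian g J
  closed : ∀ (x : M) (X Y Z : Π y : M, TangentSpace 𝓘(ℝ, E) y),
    SmoothAt X x → SmoothAt Y x → SmoothAt Z x → dTwoForm (fundamentalForm g J) X Y Z x = 0

/-- `θ` is a Lee form of the Hermitian manifold `(M, J, g)`, which is thereby locally conformally
Kähler: `θ` is a smooth closed 1-form and `dΩ = θ ∧ Ω` for the fundamental form `Ω`. -/
structure IsLeeForm (g : Metric E M)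
    (J : Π y : M, TangentSpace 𝓘(ℝ, E) y →L[ℝ] TangentSpace 𝓘(ℝ, E) y)
    (θ : Π y : M, TangentSpace 𝓘(ℝ, E) y →L[ℝ] ℝ) : Prop where
  smooth : ContMDiff 𝓘(ℝ, E) (𝓘(ℝ, E).prod 𝓘(ℝ, E →L[ℝ] ℝ)) ∞
    (fun y ↦ TotalSpace.mk' (E →L[ℝ] ℝ)
      (E := fun y : M ↦ TangentSpace 𝓘(ℝ, E) y →L[ℝ] ℝ) y (θ y))
  closed : ∀ (x : M) (X Y : Π y : M, TangentSpace 𝓘(ℝ, E) y), SmoothAt X x → SmoothAt Y x →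
    dOneForm θ X Y x = 0
  d_fundamentalForm : ∀ (x : M) (X Y Z : Π y : M, TangentSpace 𝓘(ℝ, E) y),
    SmoothAt X x → SmoothAt Y x → SmoothAt Z x →
    dTwoForm (fundamentalForm g J) X Y Z x = wedgeOneTwo θ (fundamentalForm g J) X Y Z x

variable [FiniteDimensional ℝ E]

/-- `∇θ = 0` for the Levi-Civita connection `∇` of `g`, where
`(∇_X θ)(Y) = X θ(Y) - θ(∇_X Y)`. -/
def IsParallel (g : Metric E M) (θ : Π y : M, TangentSpace 𝓘(ℝ, E) y →L[ℝ] ℝ) : Prop :=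
  ∀ (x : M) (X Y : Π y : M, TangentSpace 𝓘(ℝ, E) y), SmoothAt X x → SmoothAt Y x →
    d% (fun y ↦ θ y (Y y)) x (X x) - θ x (leviCivita g Y x (X x)) = 0

/-- `(M, J, g)` is a Vaisman manifold: a locally conformally Kähler manifold whose Lee form is
parallel. (If the Lee form vanishes, the manifold is Kähler.) -/
structure IsVaisman (g : Metric E M)
    (J : Π y : M, TangentSpace 𝓘(ℝ, E) y →L[ℝ] TangentSpace 𝓘(ℝ, E) y) : Prop where
  hermitian : IsHermitian g J
  parallel_leeForm : ∃ θ : Π y : M, TangentSpace 𝓘(ℝ, E) y →L[ℝ] ℝ,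
    IsLeeForm g J θ ∧ IsParallel g θ

end Forms

end VaismanFlat

end

/-!
Let `B` be the vector field dual to the Lee form `θ` and `ξ = J B`. The idea is that `ξ` is a
Killing field with geodesic integral curves, which on a flat manifold must be parallel, while the
equation `dΩ = θ ∧ Ω` does not allow it to be parallel where `dΩ ≠ 0`.

As `J` is integrable, `2 g((∇_X J) Y, Z) = dΩ(X, Y, Z) - dΩ(X, JY, JZ)`
(`IsHermitian.two_mul_inner_covJ`). As `B` is parallel along with `θ`, `∇_X ξ = (∇_X J) B`, and
inserting `dΩ = θ ∧ Ω` gives `2 ∇_X ξ = -|B|² JX + θ(JX) B + θ(X) ξ`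
(`two_smul_leviCivita_antiLeeField`). This operator is skew-adjoint and kills `ξ`, so
`g(R(X, ξ) ξ, X) = |∇_X ξ|²`, and flatness forces `∇ξ = 0`
(`leviCivita_antiLeeField_of_isFlat`). The formula for `∇ξ` then reads
`|B|² g(JX, Y) = θ(JX) θ(Y) - θ(X) θ(JY)`, that is, `|B|² Ω = θ ∧ g(ξ, ·)`.
Hence `|B|² θ ∧ Ω = 0`, and as `B = 0` means `θ = 0`, `dΩ = θ ∧ Ω` vanishes everywhere
(`wedgeOneTwo_eq_zero`): the manifold is Kähler.

For the curvature to be computed, `ξ` and `∇_X ξ` have to be differentiable; this rests on the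
smoothness of the metric dual of a smooth 1-form (`smoothAt_sharp`).
-/

noncomputable section

namespace VaismanFlat

/-! ### Smoothness of the metric dual of a 1-form -/

section Sharp

open Topology in
/-- A section `s` is `C^n` at `x` as soon as its image under a `C^n` field `φ` of invertible maps
is: in trivializations `s` is `φ⁻¹` applied to `φ s`, and inversion of linear maps is smooth. -/
theorem contMDiffAt_section_of_isInvertible {𝕜 F₁ F₂ : Type*} {n : WithTop ℕ∞}
    [NontriviallyNormedField 𝕜] {B EB HB : Type*} [NormedAddCommGroup EB] [NormedSpace 𝕜 EB]
    [TopologicalSpace HB] {IB : ModelWithCorners 𝕜 EB HB} [TopologicalSpace B] [ChartedSpace HB B]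
    [NormedAddCommGroup F₁] [NormedSpace 𝕜 F₁] [CompleteSpace F₁]
    [NormedAddCommGroup F₂] [NormedSpace 𝕜 F₂]
    {E₁ E₂ : B → Type*} [∀ x, AddCommGroup (E₁ x)] [∀ x, Module 𝕜 (E₁ x)]
    [∀ x, TopologicalSpace (E₁ x)] [TopologicalSpace (TotalSpace F₁ E₁)]
    [FiberBundle F₁ E₁] [VectorBundle 𝕜 F₁ E₁]
    [∀ x, AddCommGroup (E₂ x)] [∀ x, Module 𝕜 (E₂ x)]
    [∀ x, TopologicalSpace (E₂ x)] [TopologicalSpace (TotalSpace F₂ E₂)]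
    [FiberBundle F₂ E₂] [VectorBundle 𝕜 F₂ E₂]
    [∀ x, IsTopologicalAddGroup (E₂ x)] [∀ x, ContinuousSMul 𝕜 (E₂ x)]
    {φ : ∀ x, E₁ x →L[𝕜] E₂ x} {s : ∀ x, E₁ x} {x : B}
    (hφ : ContMDiffAt IB (IB.prod 𝓘(𝕜, F₁ →L[𝕜] F₂)) n
      (fun y ↦ TotalSpace.mk' (F₁ →L[𝕜] F₂) (E := fun y ↦ E₁ y →L[𝕜] E₂ y) y (φ y)) x)
    (hinv : ∀ y, (φ y).IsInvertible)
    (hs : ContMDiffAt IB (IB.prod 𝓘(𝕜, F₂)) n (fun y ↦ TotalSpace.mk' F₂ y (φ y (s y))) x) :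
    ContMDiffAt IB (IB.prod 𝓘(𝕜, F₁)) n (fun y ↦ TotalSpace.mk' F₁ y (s y)) x := by
  rw [contMDiffAt_hom_bundle] at hφ
  rw [contMDiffAt_section] at hs ⊢
  have h₁ : (trivializationAt F₁ E₁ x).baseSet ∈ 𝓝 x :=
    (trivializationAt F₁ E₁ x).open_baseSet.mem_nhds (FiberBundle.mem_baseSet_trivializationAt' x)
  have h₂ : (trivializationAt F₂ E₂ x).baseSet ∈ 𝓝 x :=
    (trivializationAt F₂ E₂ x).open_baseSet.mem_nhds (FiberBundle.mem_baseSet_trivializationAt' x)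
  have hG : ∀ y, y ∈ (trivializationAt F₁ E₁ x).baseSet →
      y ∈ (trivializationAt F₂ E₂ x).baseSet →
      (ContinuousLinearMap.inCoordinates F₁ E₁ F₂ E₂ x y x y (φ y)).IsInvertible := by
    intro y hy₁ hy₂
    rw [ContinuousLinearMap.inCoordinates_eq hy₁ hy₂]
    simpa using hinv y
  have hsm := (ContDiffAt.contMDiffAt (n := n)
    (hG x (mem_of_mem_nhds h₁) (mem_of_mem_nhds h₂)).contDiffAt_map_inverse).comp x hφ.2
  refine (hsm.clm_apply hs).congr_of_eventuallyEq ?_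
  filter_upwards [h₁, h₂] with y hy₁ hy₂
  rw [Function.comp_apply]
  symm
  change ContinuousLinearMap.inverse
    (ContinuousLinearMap.inCoordinates F₁ E₁ F₂ E₂ x y x y (φ y)) _ = _
  rw [(hG y hy₁ hy₂).inverse_apply_eq, ContinuousLinearMap.inCoordinates_eq hy₁ hy₂]
  have : (trivializationAt F₁ E₁ x ⟨y, s y⟩).2 =
      (trivializationAt F₁ E₁ x).continuousLinearEquivAt 𝕜 y hy₁ (s y) := by
    simp
  rw [this]
  simp only [ContinuousLinearMap.comp_apply, ContinuousLinearEquiv.coe_coe,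
    ContinuousLinearEquiv.symm_apply_apply]
  rfl

variable {E : Type*} [NormedAddCommGroup E] [NormedSpace ℝ E] [FiniteDimensional ℝ E]
  {M : Type*} [TopologicalSpace M] [ChartedSpace E M] [IsManifold 𝓘(ℝ, E) ∞ M]

theorem isInvertible_inner (g : Metric E M) (x : M) : (g.inner x).IsInvertible :=
  ⟨(LinearEquiv.ofBijective _ (bijective_inner g x)).toContinuousLinearEquiv, by ext; rfl⟩

/-- The vector field metrically dual to a smooth 1-form is smooth. -/
theorem smoothAt_sharp (g : Metric E M) {θ : Π y : M, TangentSpace 𝓘(ℝ, E) y →L[ℝ] ℝ} {x : M}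
    (hθ : ContMDiffAt 𝓘(ℝ, E) (𝓘(ℝ, E).prod 𝓘(ℝ, E →L[ℝ] ℝ)) ∞
      (fun y ↦ TotalSpace.mk' (E →L[ℝ] ℝ)
        (E := fun y : M ↦ TangentSpace 𝓘(ℝ, E) y →L[ℝ] ℝ) y (θ y)) x) :
    SmoothAt (fun y ↦ sharp g y (θ y)) x := by
  have : CompleteSpace E := FiniteDimensional.complete ℝ E
  refine contMDiffAt_section_of_isInvertible (g.contMDiff x) (isInvertible_inner g) ?_
  have h : ∀ y, g.inner y (sharp g y (θ y)) = θ y := fun y ↦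
    ContinuousLinearMap.ext fun w ↦ inner_sharp g y (θ y) w
  simpa only [h] using hθ

end Sharp

/-! ### The covariant derivative of the complex structure -/

section ComplexStructure

variable {E : Type*} [NormedAddCommGroup E] [NormedSpace ℝ E]
  {M : Type*} [TopologicalSpace M] [ChartedSpace E M] [IsManifold 𝓘(ℝ, E) ∞ M]

theorem SmoothAt.mdiffAt {X : Π y : M, TangentSpace 𝓘(ℝ, E) y} {x : M} (hX : SmoothAt X x) :
    MDiffAt (T% X) x :=
  ContMDiffAt.mdifferentiableAt hX (by simp)

theorem smoothAt_extend {x : M} (v : TangentSpace 𝓘(ℝ, E) x) :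
    SmoothAt (FiberBundle.extend E v) x :=
  FiberBundle.contMDiffAt_extend 𝓘(ℝ, E) E v

variable {g : Metric E M}
  {J : Π y : M, TangentSpace 𝓘(ℝ, E) y →L[ℝ] TangentSpace 𝓘(ℝ, E) y}

theorem IsHermitian.smoothAt_J (h : IsHermitian g J) {X : Π y : M, TangentSpace 𝓘(ℝ, E) y} {x : M}
    (hX : SmoothAt X x) : SmoothAt (fun y ↦ J y (X y)) x :=
  ContMDiffAt.clm_bundle_apply (h.complex.smooth x) hX

theorem IsHermitian.inner_J_left (h : IsHermitian g J) {x : M} (v w : TangentSpace 𝓘(ℝ, E) x) :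
    g.inner x (J x v) w = -g.inner x v (J x w) := by
  rw [← h.compatible x (J x v) w, h.complex.sq]
  simp

variable [FiniteDimensional ℝ E]

theorem leviCivita_neg (g : Metric E M) {Y : Π y : M, TangentSpace 𝓘(ℝ, E) y} {x : M}
    (hY : MDiffAt (T% Y) x) : leviCivita g (fun y ↦ -Y y) x = -leviCivita g Y x := by
  have h := (leviCivita g).isCovariantDerivativeOnUniv.smul_const (a := (-1 : ℝ)) hY
  have h' : (-1 : ℝ) • Y = fun y ↦ -Y y := by ext y; simp
  rw [h'] at h
  simpa using h

/-- The value `v ↦ (∇_v J) Y = ∇_v (J Y) - J (∇_v Y)` at `x` of the covariant derivative of the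
endomorphism field `J` on the vector field `Y`. -/
def covJ (g : Metric E M) (J : Π y : M, TangentSpace 𝓘(ℝ, E) y →L[ℝ] TangentSpace 𝓘(ℝ, E) y)
    (Y : Π y : M, TangentSpace 𝓘(ℝ, E) y) (x : M) :
    TangentSpace 𝓘(ℝ, E) x →L[ℝ] TangentSpace 𝓘(ℝ, E) x :=
  leviCivita g (fun y ↦ J y (Y y)) x - J x ∘L leviCivita g Y x

theorem covJ_apply (Y : Π y : M, TangentSpace 𝓘(ℝ, E) y) (x : M) (v : TangentSpace 𝓘(ℝ, E) x) :
    covJ g J Y x v = leviCivita g (fun y ↦ J y (Y y)) x v - J x (leviCivita g Y x v) :=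
  rfl

theorem d_pairing (g : Metric E M) {x : M} {Y Z : Π y : M, TangentSpace 𝓘(ℝ, E) y}
    (hY : SmoothAt Y x) (hZ : SmoothAt Z x) (v : TangentSpace 𝓘(ℝ, E) x) :
    d% (pairing g Y Z) x v
      = g.inner x (leviCivita g Y x v) (Z x) + g.inner x (Y x) (leviCivita g Z x v) := by
  simpa using leviCivita_metric g (smoothAt_extend v).mdiffAt hY.mdiffAt hZ.mdiffAt

namespace IsHermitian

variable (h : IsHermitian g J) {x : M} {X Y Z : Π y : M, TangentSpace 𝓘(ℝ, E) y}

include h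

/-- `∇_v J` is skew-adjoint. -/
theorem inner_covJ_left (hY : SmoothAt Y x) (hZ : SmoothAt Z x) (v : TangentSpace 𝓘(ℝ, E) x) :
    g.inner x (covJ g J Y x v) (Z x) = -g.inner x (covJ g J Z x v) (Y x) := by
  have h1 := d_pairing g (h.smoothAt_J hY) hZ v
  have h2 := d_pairing g hY (h.smoothAt_J hZ) v
  have h3 : pairing g (fun y ↦ J y (Y y)) Z = -pairing g Y (fun y ↦ J y (Z y)) :=
    funext fun y ↦ h.inner_J_left _ _
  rw [h3, mvfderiv_neg] at h1
  simp only [neg_apply, h2] at h1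
  have h4 : g.inner x (Y x) (J x (leviCivita g Z x v))
      = -g.inner x (leviCivita g Z x v) (J x (Y x)) := by
    rw [g.symm, h.inner_J_left]
  simp only [covJ_apply, map_sub, sub_apply, h.inner_J_left, g.symm x _ (Y x)] at h1 ⊢
  linarith

/-- `∇_v J` anticommutes with `J`. -/
theorem covJ_J (hY : SmoothAt Y x) (v : TangentSpace 𝓘(ℝ, E) x) :
    covJ g J (fun y ↦ J y (Y y)) x v = -J x (covJ g J Y x v) := by
  simp only [covJ_apply, h.complex.sq, leviCivita_neg g hY.mdiffAt, map_sub, neg_apply]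
  abel

theorem inner_covJ_J (hY : SmoothAt Y x) (v w : TangentSpace 𝓘(ℝ, E) x) :
    g.inner x (covJ g J (fun y ↦ J y (Y y)) x v) w = g.inner x (covJ g J Y x v) (J x w) := by
  simp [h.covJ_J hY, h.inner_J_left]

/-- The Nijenhuis tensor in terms of `∇J`. -/
theorem nijenhuis_eq (hX : SmoothAt X x) (hY : SmoothAt Y x) :
    covJ g J Y x (J x (X x)) - covJ g J X x (J x (Y x)) + J x (covJ g J X x (Y x))
      - J x (covJ g J Y x (X x)) = 0 := by
  rw [← h.complex.integrable x X Y hX hY, nijenhuis]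
  have hJX := (h.smoothAt_J hX).mdiffAt
  have hJY := (h.smoothAt_J hY).mdiffAt
  rw [← leviCivita_torsion g hJX hJY, ← leviCivita_torsion g hJX hY.mdiffAt,
    ← leviCivita_torsion g hX.mdiffAt hJY, ← leviCivita_torsion g hX.mdiffAt hY.mdiffAt]
  simp only [covJ_apply, map_sub, h.complex.sq]
  abel

/-- The exterior derivative of the fundamental form is the cyclic sum of `g((∇_X J) Y, Z)`. -/
theorem dTwoForm_fundamentalForm (hX : SmoothAt X x) (hY : SmoothAt Y x) (hZ : SmoothAt Z x) :
    dTwoForm (fundamentalForm g J) X Y Z x = g.inner x (covJ g J Y x (X x)) (Z x)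
      + g.inner x (covJ g J Z x (Y x)) (X x) + g.inner x (covJ g J X x (Z x)) (Y x) := by
  have e : ∀ U V : Π y : M, TangentSpace 𝓘(ℝ, E) y,
      (fun y ↦ fundamentalForm g J y (U y) (V y)) = pairing g (fun y ↦ J y (U y)) V :=
    fun U V ↦ rfl
  have e' : ∀ u v : TangentSpace 𝓘(ℝ, E) x, fundamentalForm g J x u v = g.inner x (J x u) v :=
    fun u v ↦ rfl
  rw [dTwoForm, e, e, e, d_pairing g (h.smoothAt_J hY) hZ, d_pairing g (h.smoothAt_J hZ) hX,
    d_pairing g (h.smoothAt_J hX) hY, ← leviCivita_torsion g hX.mdiffAt hY.mdiffAt,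
    ← leviCivita_torsion g hY.mdiffAt hZ.mdiffAt, ← leviCivita_torsion g hZ.mdiffAt hX.mdiffAt]
  simp only [e', covJ_apply, map_sub, sub_apply, h.inner_J_left]
  rw [g.symm x (X x), g.symm x (Y x), g.symm x (Z x)]
  simp only [h.inner_J_left]
  ring

/-- On a Hermitian manifold `dΩ` determines `∇J`: integrability of `J` makes the other terms of
`dΩ(X, Y, Z) - dΩ(X, JY, JZ)` cancel. -/
theorem two_mul_inner_covJ (hX : SmoothAt X x) (hY : SmoothAt Y x) (hZ : SmoothAt Z x) :
    2 * g.inner x (covJ g J Y x (X x)) (Z x) = dTwoForm (fundamentalForm g J) X Y Z x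
      - dTwoForm (fundamentalForm g J) X (fun y ↦ J y (Y y)) (fun y ↦ J y (Z y)) x := by
  have hJY := h.smoothAt_J hY
  have hJZ := h.smoothAt_J hZ
  -- The four terms of `dΩ` that have to cancel are the Nijenhuis identity for `Y, Z`, paired
  -- with `J X`.
  have hN := congr(g.inner x $(h.nijenhuis_eq hY hZ) (J x (X x)))
  simp only [map_sub, map_add, sub_apply, add_apply, map_zero, zero_apply, h.inner_J_left,
    h.complex.sq, map_neg] at hN
  rw [h.dTwoForm_fundamentalForm hX hY hZ, h.dTwoForm_fundamentalForm hX hJY hJZ,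
    h.inner_covJ_left hX hY (Z x), h.inner_covJ_left hX hJY (J x (Z x)), h.inner_covJ_J hY,
    h.inner_covJ_J hY, h.inner_covJ_J hZ, h.complex.sq, map_neg]
  linarith

end IsHermitian

end ComplexStructure

/-! ### The Lee field and the anti-Lee field -/

section Lee

variable {E : Type*} [NormedAddCommGroup E] [NormedSpace ℝ E] [FiniteDimensional ℝ E]
  {M : Type*} [TopologicalSpace M] [ChartedSpace E M] [IsManifold 𝓘(ℝ, E) ∞ M]
  {g : Metric E M} {J : Π y : M, TangentSpace 𝓘(ℝ, E) y →L[ℝ] TangentSpace 𝓘(ℝ, E) y}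
  {θ : Π y : M, TangentSpace 𝓘(ℝ, E) y →L[ℝ] ℝ}

/-- The Lee field `B`, metrically dual to the 1-form `θ`. -/
def leeField (g : Metric E M) (θ : Π y : M, TangentSpace 𝓘(ℝ, E) y →L[ℝ] ℝ) (y : M) :
    TangentSpace 𝓘(ℝ, E) y :=
  sharp g y (θ y)

/-- The anti-Lee field `ξ = J B`. -/
def antiLeeField (g : Metric E M)
    (J : Π y : M, TangentSpace 𝓘(ℝ, E) y →L[ℝ] TangentSpace 𝓘(ℝ, E) y)
    (θ : Π y : M, TangentSpace 𝓘(ℝ, E) y →L[ℝ] ℝ) (y : M) : TangentSpace 𝓘(ℝ, E) y :=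
  J y (leeField g θ y)

theorem inner_leeField (x : M) (v : TangentSpace 𝓘(ℝ, E) x) :
    g.inner x (leeField g θ x) v = θ x v :=
  inner_sharp g x (θ x) v

theorem IsHermitian.inner_antiLeeField (h : IsHermitian g J) (x : M)
    (v : TangentSpace 𝓘(ℝ, E) x) :
    g.inner x (antiLeeField g J θ x) v = -θ x (J x v) := by
  rw [antiLeeField, h.inner_J_left, inner_leeField]

theorem IsHermitian.leeForm_antiLeeField (h : IsHermitian g J) (x : M) :
    θ x (antiLeeField g J θ x) = 0 := by
  have h1 := h.inner_antiLeeField (θ := θ) x (leeField g θ x)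
  rw [g.symm, inner_leeField] at h1
  change _ = -θ x (antiLeeField g J θ x) at h1
  linarith

theorem IsLeeForm.smoothAt_leeField (hθ : IsLeeForm g J θ) (x : M) :
    SmoothAt (leeField g θ) x :=
  smoothAt_sharp g (hθ.smooth x)

theorem IsLeeForm.smoothAt_antiLeeField (h : IsHermitian g J) (hθ : IsLeeForm g J θ) (x : M) :
    SmoothAt (antiLeeField g J θ) x :=
  h.smoothAt_J (hθ.smoothAt_leeField x)

/-- The Lee field of a parallel Lee form is parallel. -/
theorem leviCivita_leeField (hθ : IsLeeForm g J θ) (hpar : IsParallel g θ) (x : M) :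
    leviCivita g (leeField g θ) x = 0 := by
  ext v
  refine metric_ext g x fun w ↦ ?_
  have h1 := hpar x _ _ (smoothAt_extend v) (smoothAt_extend w)
  have h2 := d_pairing g (hθ.smoothAt_leeField x) (smoothAt_extend w) v
  have h3 : pairing g (leeField g θ) (FiberBundle.extend E w)
      = fun y ↦ θ y (FiberBundle.extend E w y) := funext fun y ↦ inner_leeField y _
  simp only [FiberBundle.extend_apply_self, h3, inner_leeField] at h1 h2
  simp only [zero_apply, map_zero]
  linarith

/-- On a Vaisman manifold `2 ∇_v ξ = -|B|² J v + θ(J v) B + θ(v) ξ`. -/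
theorem two_smul_leviCivita_antiLeeField (h : IsHermitian g J) (hθ : IsLeeForm g J θ)
    (hpar : IsParallel g θ) (x : M) (v : TangentSpace 𝓘(ℝ, E) x) :
    (2 : ℝ) • leviCivita g (antiLeeField g J θ) x v
      = -(θ x (leeField g θ x) • J x v) + θ x (J x v) • leeField g θ x
        + θ x v • antiLeeField g J θ x := by
  refine metric_ext g x fun w ↦ ?_
  have hB := hθ.smoothAt_leeField x
  have hv := smoothAt_extend v
  have hw := smoothAt_extend w
  -- Since `B` is parallel, `∇_v ξ = (∇_v J) B`, and `∇J` is known from `dΩ = θ ∧ Ω`.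
  have h1 := h.two_mul_inner_covJ hv hB hw
  rw [hθ.d_fundamentalForm x _ _ _ hv hB hw,
    hθ.d_fundamentalForm x _ _ _ hv (h.smoothAt_J hB) (h.smoothAt_J hw)] at h1
  have h2 : covJ g J (leeField g θ) x v = leviCivita g (antiLeeField g J θ) x v := by
    rw [covJ_apply, leviCivita_leeField hθ hpar, zero_apply, map_zero, sub_zero]
    rfl
  have e' : ∀ u v : TangentSpace 𝓘(ℝ, E) x, fundamentalForm g J x u v = g.inner x (J x u) v :=
    fun u v ↦ rfl
  have h3 : θ x (J x (leeField g θ x)) = 0 := h.leeForm_antiLeeField x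
  have h4 : ∀ u, g.inner x u (leeField g θ x) = θ x u := fun u ↦ by rw [g.symm, inner_leeField]
  have h5 : g.inner x (J x (leeField g θ x)) w = -θ x (J x w) := h.inner_antiLeeField x w
  simp only [FiberBundle.extend_apply_self, h2, wedgeOneTwo, e', h.complex.sq, map_neg, neg_apply,
    h.compatible, h.inner_J_left w v, h3, h4, h5, g.symm x w (J x v),
    inner_leeField] at h1
  simp only [map_smul, smul_apply, map_add, add_apply, map_neg, neg_apply, inner_leeField,
    h.inner_antiLeeField, smul_eq_mul]
  linarith

/-- On a Vaisman manifold the anti-Lee field is Killing: `∇ξ` is skew-adjoint. -/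
theorem inner_leviCivita_antiLeeField_self (h : IsHermitian g J) (hθ : IsLeeForm g J θ)
    (hpar : IsParallel g θ) (x : M) (v : TangentSpace 𝓘(ℝ, E) x) :
    g.inner x (leviCivita g (antiLeeField g J θ) x v) v = 0 := by
  have h1 := congr(g.inner x $(two_smul_leviCivita_antiLeeField h hθ hpar x v) v)
  have h2 : g.inner x (J x v) v = 0 := by
    have := h.inner_J_left v v
    rw [g.symm x v] at this
    linarith
  simp only [map_smul, smul_apply, map_add, add_apply, map_neg, neg_apply, inner_leeField,
    h.inner_antiLeeField, smul_eq_mul, h2] at h1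
  linarith

theorem leviCivita_antiLeeField_self (h : IsHermitian g J) (hθ : IsLeeForm g J θ)
    (hpar : IsParallel g θ) (x : M) :
    leviCivita g (antiLeeField g J θ) x (antiLeeField g J θ x) = 0 := by
  have h1 := two_smul_leviCivita_antiLeeField h hθ hpar x (antiLeeField g J θ x)
  have h2 : J x (antiLeeField g J θ x) = -leeField g θ x := h.complex.sq x _
  rw [h.leeForm_antiLeeField, h2] at h1
  simpa using h1

/-- `∇_X ξ` is differentiable, since it is an algebraic expression in `X`, `J`, `θ` and `B`. -/
theorem mdiffAt_leviCivita_antiLeeField (h : IsHermitian g J) (hθ : IsLeeForm g J θ)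
    (hpar : IsParallel g θ) {x : M} {X : Π y : M, TangentSpace 𝓘(ℝ, E) y} (hX : SmoothAt X x) :
    MDiffAt (T% (fun y ↦ leviCivita g (antiLeeField g J θ) y (X y))) x := by
  have hB := hθ.smoothAt_leeField x
  have hp : ∀ {Y : Π y : M, TangentSpace 𝓘(ℝ, E) y}, SmoothAt Y x →
      MDiffAt (fun y ↦ θ y (Y y)) x := fun {Y} hY ↦ by
    have := pairing_mdifferentiableAt g hB.mdiffAt hY.mdiffAt
    rwa [show pairing g (leeField g θ) Y = fun y ↦ θ y (Y y) from
      funext fun y ↦ inner_leeField y (Y y)] at this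
  have h1 : (fun y ↦ leviCivita g (antiLeeField g J θ) y (X y)) = (2⁻¹ : ℝ) •
      (-((fun y ↦ θ y (leeField g θ y)) • fun y ↦ J y (X y))
        + (fun y ↦ θ y (J y (X y))) • leeField g θ + (fun y ↦ θ y (X y)) • antiLeeField g J θ) := by
    ext y
    exact (inv_smul_eq_iff₀ two_ne_zero).2
      (two_smul_leviCivita_antiLeeField h hθ hpar y (X y)).symm |>.symm
  change MDifferentiableAt 𝓘(ℝ, E) (𝓘(ℝ, E).prod 𝓘(ℝ, E))
    (fun y ↦ TotalSpace.mk' E y ((fun y ↦ leviCivita g (antiLeeField g J θ) y (X y)) y)) x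
  rw [h1]
  have hJX := h.smoothAt_J hX
  exact MDifferentiableAt.smul_const_section <| mdifferentiableAt_add_section
    (mdifferentiableAt_add_section
      (mdifferentiableAt_neg_section (MDifferentiableAt.smul_section (hp hB) hJX.mdiffAt))
      (MDifferentiableAt.smul_section (hp hJX) hB.mdiffAt))
    (MDifferentiableAt.smul_section (hp hX) (hθ.smoothAt_antiLeeField h x).mdiffAt)

/-- If `g` is flat then the Killing field `ξ`, whose integral curves are geodesics, is parallel:
`0 = g(R(X, ξ)ξ, X) = |∇_X ξ|²`. -/
theorem leviCivita_antiLeeField_of_isFlat (h : IsHermitian g J) (hθ : IsLeeForm g J θ)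
    (hpar : IsParallel g θ) (hflat : IsFlat g) (x : M) (v : TangentSpace 𝓘(ℝ, E) x) :
    leviCivita g (antiLeeField g J θ) x v = 0 := by
  set ξ := antiLeeField g J θ
  set X := FiberBundle.extend E v
  have hX : SmoothAt X x := smoothAt_extend v
  have hξ : SmoothAt ξ x := hθ.smoothAt_antiLeeField h x
  have hskew := inner_leviCivita_antiLeeField_self h hθ hpar
  have hpol : ∀ a b, g.inner x (leviCivita g ξ x a) b = -g.inner x (leviCivita g ξ x b) a := by
    intro a b
    have h1 := hskew x (a + b)
    simp only [map_add, add_apply, hskew] at h1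
    linarith
  -- The vector field `∇_ξ ξ` vanishes identically, so `∇_X ∇_ξ ξ` drops out of the curvature.
  have hR := hflat x X ξ ξ hX hξ hξ
  have h0 : (fun y ↦ leviCivita g ξ y (ξ y)) = 0 :=
    funext fun y ↦ leviCivita_antiLeeField_self h hθ hpar y
  rw [h0, CovariantDerivative.zero, ← leviCivita_torsion g hX.mdiffAt hξ.mdiffAt] at hR
  -- Differentiating `g(∇_X ξ, X) = 0` along `ξ` evaluates the term `g(∇_ξ ∇_X ξ, X)`.
  have hd := leviCivita_metric g hξ.mdiffAt (mdiffAt_leviCivita_antiLeeField h hθ hpar hX)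
    hX.mdiffAt
  have hd0 : pairing g (fun y ↦ leviCivita g ξ y (X y)) X = fun _ ↦ 0 :=
    funext fun y ↦ hskew y (X y)
  rw [hd0, mvfderiv_const] at hd
  have hR' := congr(g.inner x $hR (X x))
  have hXx : X x = v := FiberBundle.extend_apply_self E v
  simp only [Pi.zero_apply, zero_apply, map_sub, sub_apply, map_zero, hpol _ (X x)] at hR' hd
  simp only [hXx] at hR' hd
  have : g.inner x (leviCivita g ξ x v) (leviCivita g ξ x v) = 0 := by linarith
  by_contra hne
  exact (g.pos x _ hne).ne' this

/-- If `∇ξ = 0` at `x`, then `|B|² Ω = θ ∧ g(ξ, ·)` there, and so `θ ∧ Ω = 0`. -/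
theorem wedgeOneTwo_eq_zero (h : IsHermitian g J) (hθ : IsLeeForm g J θ)
    (hpar : IsParallel g θ) {x : M} (hξ : ∀ v, leviCivita g (antiLeeField g J θ) x v = 0)
    (X Y Z : Π y : M, TangentSpace 𝓘(ℝ, E) y) :
    wedgeOneTwo θ (fundamentalForm g J) X Y Z x = 0 := by
  have hΩ : ∀ v w, θ x (leeField g θ x) * fundamentalForm g J x v w
      = θ x (J x v) * θ x w - θ x v * θ x (J x w) := by
    intro v w
    have h1 := congr(g.inner x $(two_smul_leviCivita_antiLeeField h hθ hpar x v) w)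
    simp only [hξ, smul_zero, zero_apply, map_zero, map_smul, smul_apply, map_add, add_apply,
      map_neg, neg_apply, inner_leeField, h.inner_antiLeeField, smul_eq_mul] at h1
    change _ * g.inner x (J x v) w = _
    linarith
  by_cases hB : leeField g θ x = 0
  · have h1 : ∀ v, θ x v = 0 := fun v ↦ by rw [← inner_leeField (g := g), hB]; simp
    simp [wedgeOneTwo, h1]
  · have hc := (g.pos x _ hB).ne'
    rw [inner_leeField] at hc
    refine (mul_eq_zero.1 ?_).resolve_left hc
    simp only [wedgeOneTwo, mul_add, mul_left_comm (θ x (leeField g θ x)), hΩ]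
    ring

end Lee

end VaismanFlat

end

theorem mainTheorem6 {E : Type*} [NormedAddCommGroup E] [NormedSpace ℝ E] [FiniteDimensional ℝ E]
    {M : Type*} [TopologicalSpace M] [ChartedSpace E M] [IsManifold 𝓘(ℝ, E) ∞ M]
    (g : VaismanFlat.Metric E M)
    (J : Π x : M, TangentSpace 𝓘(ℝ, E) x →L[ℝ] TangentSpace 𝓘(ℝ, E) x)
    (hV : VaismanFlat.IsVaisman g J) (hK : ¬ VaismanFlat.IsKahler g J) :
    ¬ VaismanFlat.IsFlat g := by
  intro hflat
  obtain ⟨h, θ, hθ, hpar⟩ := hV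
  refine hK ⟨h, fun x X Y Z hX hY hZ ↦ ?_⟩
  rw [hθ.d_fundamentalForm x X Y Z hX hY hZ]
  exact VaismanFlat.wedgeOneTwo_eq_zero h hθ hpar
    (VaismanFlat.leviCivita_antiLeeField_of_isFlat h hθ hpar hflat x) X Y Z
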